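/- Let $d\in\mathbb N$, let $\mathbb F^d$ be the free monoid on $d$ letters, let $\mathbb H^2_d=\ell^2(\mathbb F^d)$ be the full Fock space over $\mathbb C^d$ with standard orthonormal basis $(e_\alpha)_{\alpha\in\mathbb F^d}$ and vacuum vector $1=e_\emptyset$, and let $L_1,\dots,L_d$ be the left free shifts, the isometries with $L_k e_\alpha=e_{k\alpha}$. Let $\mathcal A_d=\mathrm{Alg}\{I,L_1,\dots,L_d\}^{-\|\cdot\|}$ be the free disk algebra, regarded also as the dense subspace $\{a1: a\in\mathcal A_d\}$ of $\mathbb H^2_d$ through the injective map $a\mapsto a1$, and let $\mathscr A_d=(\mathcal A_d+\mathcal A_d^*)^{-\|\cdot\|}$ be the free disk system. A (positive) NC measure is a positive linear functional $\mu$ on $\mathscr A_d$. Its form is $q_\mu(a_1,a_2)=\mu(a_1^*a_2)$ for $a_1,a_2\in\mathcal A_d$, with form domain $\mathcal A_d\subset\mathbb H^2_d$ (inner products and forms are conjugate linear in the first argument). A densely defined positive semi-definite form $q$ in a Hilbert space is closed if $\mathrm{Dom}\,q$ is complete for the norm $(q(h,h)+\|h\|^2)^{1/2}$; it is closable if it has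 a closed positive semi-definite extension, and its closure is then its minimal closed positive semi-definite extension. The NC measure $\mu$ is absolutely continuous if $q_\mu$ is closable. A positive semi-definite form $q$ with dense domain in $\mathbb H^2_d$ is $L$-Toeplitz if $L_k\,\mathrm{Dom}\,q\subseteq\mathrm{Dom}\,q$ for all $k$ and $q(L_jg,L_kh)=\delta_{j,k}\,q(g,h)$ for all $j,k$ and all $g,h\in\mathrm{Dom}\,q$. A closed, densely defined, positive semi-definite (that is, positive self-adjoint, possibly unbounded) operator $T$ in $\mathbb H^2_d$ is $L$-Toeplitz if its form $q_T(g,h)=\langle\sqrt T g,\sqrt T h\rangle$, $g,h\in\mathrm{Dom}\,\sqrt T$, is $L$-Toeplitz. Theorem. Let $\mu$ be an absolutely continuous positive NC measure. Then there is a unique closed, densely defined, positive semi-definite $L$-Toeplitz operator $T$ in $\mathbb H^2_d$ such that $q_T$ is the closure of $q_\mu$. Moreover, $\mathcal A_d$ is a core for $\sqrt T$, that is, $\mathcal A_d\subseteq\mathrm{Dom}\,\sqrt T$ and $\sqrt T$ is the closure of its restriction to $\mathcal A_d$. -/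

import Mathlib

open scoped ComplexOrder InnerProductSpace

noncomputable section

namespace NCFatou

/-! ### The full Fock space and the free disk system -/

/-- The full Fock space over `ℂ^d`, as square-summable families indexed by the free monoid on
`d` letters. -/
abbrev Fock (d : ℕ) : Type := lp (fun _ : FreeMonoid (Fin d) => ℂ) 2

open scoped Classical in
/-- The standard orthonormal basis vector labelled by the word `α`. -/
def basisVec (d : ℕ) (α : FreeMonoid (Fin d)) : Fock d := lp.single 2 α (1 : ℂ)

/-- The isometry `e_α ↦ e_{φ α}` attached to an injective map `φ` of words. -/
def pushIsom {d : ℕ} (φ : FreeMonoid (Fin d) → FreeMonoid (Fin d))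
    (hφ : Function.Injective φ) : Fock d →ₗᵢ[ℂ] Fock d where
  toFun f := ⟨Function.extend φ (f : FreeMonoid (Fin d) → ℂ) 0, by
    have h := (lp.memℓp f).summable (by norm_num)
    refine memℓp_gen ?_
    rw [← hφ.summable_iff]
    · refine h.congr fun w => ?_
      simp [hφ.extend_apply]
    · intro w hw
      rw [Function.extend_apply' _ _ _ (by simpa using hw)]
      simp⟩
  map_add' f g := by
    refine lp.ext (funext fun w => ?_)
    change Function.extend φ (⇑f + ⇑g) 0 w = Function.extend φ f 0 w + Function.extend φ g 0 w
    by_cases hw : ∃ v, φ v = w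
    · obtain ⟨v, rfl⟩ := hw
      simp only [hφ.extend_apply]
      rfl
    · simp [Function.extend_apply' _ _ _ hw]
  map_smul' c f := by
    refine lp.ext (funext fun w => ?_)
    change Function.extend φ (c • ⇑f) 0 w = c * Function.extend φ f 0 w
    by_cases hw : ∃ v, φ v = w
    · obtain ⟨v, rfl⟩ := hw
      simp only [hφ.extend_apply]
      rfl
    · simp [Function.extend_apply' _ _ _ hw]
  norm_map' f := by
    rw [lp.norm_eq_tsum_rpow (by norm_num), lp.norm_eq_tsum_rpow (by norm_num)]
    congr 1
    rw [← hφ.tsum_eq]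
    · refine tsum_congr fun w => ?_
      simp [hφ.extend_apply]
    · intro w hw
      by_contra h
      refine hw ?_
      simp [Function.extend_apply' _ _ _ (show ¬ ∃ v, φ v = w by simpa using h)]

theorem pushIsom_apply {d : ℕ} {φ : FreeMonoid (Fin d) → FreeMonoid (Fin d)}
    (hφ : Function.Injective φ) (f : Fock d) (w : FreeMonoid (Fin d)) :
    pushIsom φ hφ f (φ w) = f w :=
  hφ.extend_apply _ _ _

theorem pushIsom_apply_of_notMem {d : ℕ} {φ : FreeMonoid (Fin d) → FreeMonoid (Fin d)}
    (hφ : Function.Injective φ) (f : Fock d) {w : FreeMonoid (Fin d)} (hw : ¬ ∃ v, φ v = w) :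
    pushIsom φ hφ f w = 0 :=
  Function.extend_apply' _ _ _ hw

theorem pushIsom_pushIsom {d : ℕ} {φ ψ : FreeMonoid (Fin d) → FreeMonoid (Fin d)}
    (hφ : Function.Injective φ) (hψ : Function.Injective ψ) (f : Fock d) :
    pushIsom φ hφ (pushIsom ψ hψ f) = pushIsom (φ ∘ ψ) (hφ.comp hψ) f := by
  refine lp.ext (funext fun w => ?_)
  by_cases hw : ∃ v, φ v = w
  · obtain ⟨v, rfl⟩ := hw
    rw [pushIsom_apply]
    by_cases hv : ∃ u, ψ u = v
    · obtain ⟨u, rfl⟩ := hv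
      rw [pushIsom_apply]
      exact (pushIsom_apply (hφ.comp hψ) f u).symm
    · rw [pushIsom_apply_of_notMem hψ _ hv, pushIsom_apply_of_notMem]
      rintro ⟨u, hu⟩
      exact hv ⟨u, hφ hu⟩
  · rw [pushIsom_apply_of_notMem hφ _ hw, pushIsom_apply_of_notMem]
    rintro ⟨u, hu⟩
    exact hw ⟨ψ u, hu⟩

open scoped Classical in
theorem basisVec_apply (d : ℕ) (α w : FreeMonoid (Fin d)) :
    basisVec d α w = if w = α then 1 else 0 := by
  rw [basisVec, lp.single_apply, Pi.single_apply]

open scoped Classical in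
theorem pushIsom_basisVec {d : ℕ} {φ : FreeMonoid (Fin d) → FreeMonoid (Fin d)}
    (hφ : Function.Injective φ) (α : FreeMonoid (Fin d)) :
    pushIsom φ hφ (basisVec d α) = basisVec d (φ α) := by
  refine lp.ext (funext fun w => ?_)
  rw [basisVec_apply]
  by_cases hw : ∃ v, φ v = w
  · obtain ⟨v, rfl⟩ := hw
    rw [pushIsom_apply, basisVec_apply]
    exact if_congr hφ.eq_iff.symm rfl rfl
  · rw [pushIsom_apply_of_notMem hφ _ hw, if_neg fun h => hw ⟨α, h.symm⟩]

/-- The left free shift `L_k`, acting by `L_k e_α = e_{kα}`. -/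
def leftShift (d : ℕ) (k : Fin d) : Fock d →L[ℂ] Fock d :=
  (pushIsom (fun α => FreeMonoid.of k * α)
    (fun _ _ h => mul_left_cancel h)).toContinuousLinearMap

theorem leftShift_basisVec (d : ℕ) (k : Fin d) (α : FreeMonoid (Fin d)) :
    leftShift d k (basisVec d α) = basisVec d (FreeMonoid.of k * α) :=
  pushIsom_basisVec (fun _ _ h => mul_left_cancel h) α

/-- The free disk algebra: the operator-norm closed unital algebra generated by the left free
shifts. -/
def freeDiskAlgebra (d : ℕ) : Subalgebra ℂ (Fock d →L[ℂ] Fock d) :=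
  (Algebra.adjoin ℂ (Set.range (leftShift d))).topologicalClosure

/-- The free disk system: the operator-norm closure of `A_d + A_d^*`. -/
def freeDiskSystem (d : ℕ) : Submodule ℂ (Fock d →L[ℂ] Fock d) :=
  (Subalgebra.toSubmodule (freeDiskAlgebra d) ⊔
    Subalgebra.toSubmodule (star (freeDiskAlgebra d))).topologicalClosure

/-- Positive NC measures: positive linear functionals on the free disk system, for the order
inherited from the bounded operators on the Fock space (`a ≤ b` iff `b - a` is positive
semi-definite). -/
abbrev NCMeasure (d : ℕ) : Type := freeDiskSystem d →ₚ[ℂ] ℂ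

/-! The form of an NC measure is well defined: `A_d^* A_d` is contained in the free disk system,
and `a ↦ a 1` embeds `A_d` into the Fock space. -/

theorem star_leftShift_mul (d : ℕ) (j k : Fin d) :
    star (leftShift d j) * leftShift d k = if j = k then 1 else 0 := by
  refine ContinuousLinearMap.ext fun g => ext_inner_left ℂ fun f => ?_
  have h1 : ⟪f, (star (leftShift d j) * leftShift d k) g⟫_ℂ
      = ⟪leftShift d j f, leftShift d k g⟫_ℂ := by
    rw [ContinuousLinearMap.star_eq_adjoint, mul_apply_eq_comp,
      ContinuousLinearMap.adjoint_inner_right]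
  rw [h1]
  split_ifs with h
  · subst h
    exact LinearIsometry.inner_map_map _ f g
  · rw [lp.inner_eq_tsum]
    rw [show (0 : Fock d →L[ℂ] Fock d) g = 0 from rfl, inner_zero_right]
    refine (tsum_congr fun w => ?_).trans tsum_zero
    have hinj : ∀ i : Fin d, Function.Injective (fun α : FreeMonoid (Fin d) =>
        FreeMonoid.of i * α) := fun _ _ _ h => mul_left_cancel h
    by_cases hw : ∃ v, FreeMonoid.of j * v = w
    · have hk : ¬ ∃ v, FreeMonoid.of k * v = w := by
        rintro ⟨v, hv⟩
        obtain ⟨u, hu⟩ := hw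
        have := congrArg FreeMonoid.toList (hu.trans hv.symm)
        simp at this
        exact h this.1
      have : leftShift d k g w = 0 := pushIsom_apply_of_notMem (hinj k) g hk
      rw [this, inner_zero_right]
    · have : leftShift d j f w = 0 := pushIsom_apply_of_notMem (hinj j) f hw
      rw [this, inner_zero_left]

theorem star_mul_mem_freeDiskSystem {d : ℕ} {a b : Fock d →L[ℂ] Fock d}
    (ha : a ∈ freeDiskAlgebra d) (hb : b ∈ freeDiskAlgebra d) :
    star a * b ∈ freeDiskSystem d := by
  set M := Submonoid.closure (Set.range (leftShift d)) with hM
  have hMA : ∀ x ∈ M, x ∈ freeDiskAlgebra d := fun x hx =>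
    Subalgebra.le_topologicalClosure _ (Algebra.adjoin_eq_span ℂ (Set.range (leftShift d)) ▸
      Submodule.subset_span hx : x ∈ Subalgebra.toSubmodule _)
  have hA : ∀ x ∈ freeDiskAlgebra d, x ∈ freeDiskSystem d := fun x hx =>
    Submodule.le_topologicalClosure _ (Submodule.mem_sup_left hx)
  have hA' : ∀ x ∈ freeDiskAlgebra d, star x ∈ freeDiskSystem d := fun x hx =>
    Submodule.le_topologicalClosure _ (Submodule.mem_sup_right
      (show star x ∈ star (freeDiskAlgebra d) by simpa using hx))
  have hmono : ∀ u ∈ M, ∀ v ∈ M, star u * v ∈ freeDiskSystem d := by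
    intro u hu
    induction hu using Submonoid.closure_induction_left with
    | one => intro v hv; simpa using hA v (hMA v hv)
    | mul_left x hx u hu ih =>
      intro v hv
      obtain ⟨j, rfl⟩ := hx
      induction hv using Submonoid.closure_induction_left with
      | one =>
        rw [mul_one]
        exact hA' _ (hMA _ (M.mul_mem (Submonoid.subset_closure ⟨j, rfl⟩) hu))
      | mul_left y hy v hv _ =>
        obtain ⟨k, rfl⟩ := hy
        have : star (leftShift d j * u) * (leftShift d k * v)
            = star u * ((star (leftShift d j) * leftShift d k) * v) := by
          simp only [star_mul, mul_assoc]
        rw [this, star_leftShift_mul]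
        split_ifs
        · simpa using ih v hv
        · simp
  have hpoly : ∀ u ∈ Algebra.adjoin ℂ (Set.range (leftShift d)),
      ∀ v ∈ Algebra.adjoin ℂ (Set.range (leftShift d)), star u * v ∈ freeDiskSystem d := by
    intro u hu v hv
    rw [← Subalgebra.mem_toSubmodule, Algebra.adjoin_eq_span] at hu hv
    induction hu using Submodule.span_induction with
    | zero => simp
    | add x y _ _ hx hy => rw [star_add, add_mul]; exact Submodule.add_mem _ hx hy
    | smul c x _ hx => rw [star_smul, smul_mul_assoc]; exact Submodule.smul_mem _ _ hx
    | mem x hx =>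
      induction hv using Submodule.span_induction with
      | zero => simp
      | add y z _ _ hy hz => rw [mul_add]; exact Submodule.add_mem _ hy hz
      | smul c y _ hy => rw [mul_smul_comm]; exact Submodule.smul_mem _ _ hy
      | mem y hy => exact hmono x hx y hy
  have hcl : star a * b ∈ closure (freeDiskSystem d : Set (Fock d →L[ℂ] Fock d)) :=
    map_mem_closure₂ (f := fun x y : Fock d →L[ℂ] Fock d => star x * y) (by fun_prop)
      ha hb hpoly
  exact (Submodule.isClosed_topologicalClosure _).closure_subset hcl

/-- The embedding `a ↦ a 1` of the free disk algebra into the Fock space, `1` being the vacuum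
vector. -/
def vacuumMap (d : ℕ) : freeDiskAlgebra d →ₗ[ℂ] Fock d where
  toFun a := (a : Fock d →L[ℂ] Fock d) (basisVec d 1)
  map_add' _ _ := rfl
  map_smul' _ _ := rfl

theorem vacuumMap_injective (d : ℕ) : Function.Injective (vacuumMap d) := by
  rw [injective_iff_map_eq_zero]
  rintro ⟨a, ha⟩ h0
  have h0 : a (basisVec d 1) = 0 := h0
  have hr : ∀ β : FreeMonoid (Fin d), Function.Injective (fun α => α * β) :=
    fun β _ _ h => mul_right_cancel h
  -- elements of the algebra commute with the right shifts
  have hcomm : ∀ β, Commute a (pushIsom (fun α => α * β) (hr β)).toContinuousLinearMap := by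
    intro β
    set R := (pushIsom (fun α => α * β) (hr β)).toContinuousLinearMap with hR
    have hset : IsClosed {x : Fock d →L[ℂ] Fock d | x * R = R * x} :=
      isClosed_eq (by fun_prop) (by fun_prop)
    have hsub : (Algebra.adjoin ℂ (Set.range (leftShift d)) : Set (Fock d →L[ℂ] Fock d))
        ⊆ {x | x * R = R * x} := by
      intro x hx
      have hx' : x ∈ Subalgebra.centralizer ℂ {R} := by
        refine Algebra.adjoin_le ?_ hx
        rintro _ ⟨k, rfl⟩
        refine Subalgebra.mem_centralizer_iff ℂ |>.2 ?_
        rintro _ rfl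
        refine ContinuousLinearMap.ext fun f => ?_
        have hk : Function.Injective (fun α : FreeMonoid (Fin d) => FreeMonoid.of k * α) :=
          fun _ _ h => mul_left_cancel h
        change pushIsom _ (hr β) (pushIsom _ hk f) = pushIsom _ hk (pushIsom _ (hr β) f)
        rw [pushIsom_pushIsom, pushIsom_pushIsom]
        simp only [Function.comp_def, mul_assoc]
      exact ((Subalgebra.mem_centralizer_iff ℂ).1 hx' R rfl).symm
    exact closure_minimal hsub hset ha
  have hb : ∀ β, a (basisVec d β) = 0 := by
    intro β
    have h1 := congrArg (fun T : Fock d →L[ℂ] Fock d => T (basisVec d 1)) (hcomm β).eq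
    have h2 : (pushIsom (fun α => α * β) (hr β)) (basisVec d 1) = basisVec d β := by
      rw [pushIsom_basisVec, one_mul]
    simpa [h2, h0] using h1
  classical
  refine Subtype.ext (ContinuousLinearMap.ext fun f => ?_)
  have hs := (lp.hasSum_single (p := 2) (by norm_num) f).mapL a
  have hz : ∀ α, a (lp.single 2 α (f α)) = 0 := fun α => ?_
  · simp only [hz] at hs
    exact hs.unique hasSum_zero
  have : lp.single 2 α (f α) = f α • basisVec d α := by
    refine lp.ext (funext fun w => ?_)
    rw [lp.coeFn_smul, Pi.smul_apply, basisVec_apply, lp.single_apply, Pi.single_apply]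
    split_ifs with h
    · subst h; simp
    · simp
  rw [this, map_smul, hb, smul_zero]

/-! ### Sesquilinear forms in a Hilbert space -/

section Forms

variable {H : Type*} [NormedAddCommGroup H] [InnerProductSpace ℂ H]

/-- A sesquilinear form with a linear domain in `H`, conjugate linear in its first argument. -/
structure SesqForm (H : Type*) [NormedAddCommGroup H] [InnerProductSpace ℂ H] where
  /-- The form domain. -/
  domain : Submodule ℂ H
  /-- The values of the form. -/
  form : domain →ₗ⋆[ℂ] domain →ₗ[ℂ] ℂ

namespace SesqForm

/-- A positive semi-definite form with dense domain. -/
structure IsPosSemidef (q : SesqForm H) : Prop where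
  dense : Dense (q.domain : Set H)
  nonneg : ∀ h : q.domain, 0 ≤ q.form h h

/-- The square of the norm `‖h‖_{q+1}`, namely `q(h, h) + ‖h‖²`. -/
def plusOneNormSq (q : SesqForm H) (h : q.domain) : ℝ := (q.form h h).re + ‖(h : H)‖ ^ 2

/-- A positive semi-definite form is closed if its domain is complete in the norm
`‖·‖_{q+1}`: every Cauchy sequence for this norm converges in the domain. -/
def IsClosed (q : SesqForm H) : Prop :=
  ∀ u : ℕ → q.domain,
    (∀ ε : ℝ, 0 < ε → ∃ N, ∀ m n, N ≤ m → N ≤ n → q.plusOneNormSq (u m - u n) < ε) →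
    ∃ h : q.domain, Filter.Tendsto (fun n => q.plusOneNormSq (u n - h)) Filter.atTop (nhds 0)

/-- `q.IsExtendedBy p`: the form `p` extends the form `q`. -/
def IsExtendedBy (q p : SesqForm H) : Prop :=
  ∃ hle : q.domain ≤ p.domain, ∀ g h : q.domain,
    p.form ⟨g, hle g.2⟩ ⟨h, hle h.2⟩ = q.form g h

/-- A form is closable if it has a closed (positive semi-definite) extension. -/
def IsClosable (q : SesqForm H) : Prop :=
  ∃ p : SesqForm H, p.IsPosSemidef ∧ p.IsClosed ∧ q.IsExtendedBy p

/-- `q.IsClosure p`: the form `p` is the closure of `q`, that is, its minimal closed (positive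
semi-definite) extension. -/
structure IsClosure (q p : SesqForm H) : Prop where
  posSemidef : p.IsPosSemidef
  closed : p.IsClosed
  extends_form : q.IsExtendedBy p
  minimal : ∀ r : SesqForm H, r.IsPosSemidef → r.IsClosed → q.IsExtendedBy r → p.IsExtendedBy r

/-- The form `(g, h) ↦ ⟪S g, S h⟫` on the domain of an operator `S`. -/
def ofOperator (S : H →ₗ.[ℂ] H) : SesqForm H where
  domain := S.domain
  form := LinearMap.mk₂'ₛₗ (starRingEnd ℂ) (RingHom.id ℂ) (fun g h => ⟪S g, S h⟫_ℂ)
    (fun g g' h => by rw [S.map_add, inner_add_left])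
    (fun c g h => by rw [S.map_smul, inner_smul_left, smul_eq_mul])
    (fun g h h' => by rw [S.map_add, inner_add_right])
    (fun c g h => by rw [S.map_smul, inner_smul_right, smul_eq_mul, RingHom.id_apply])

theorem ofOperator_form (S : H →ₗ.[ℂ] H) (g h : S.domain) :
    (ofOperator S).form g h = ⟪S g, S h⟫_ℂ := rfl

end SesqForm

/-! ### Unbounded positive operators and their square roots -/

variable [CompleteSpace H]

/-- Positive semi-definite (possibly unbounded) operators: self-adjoint operators `T` with
`⟪x, T x⟫ ≥ 0` on the domain. Such operators are closed and densely defined. -/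
structure IsPosOperator (T : H →ₗ.[ℂ] H) : Prop where
  selfAdjoint : IsSelfAdjoint T
  nonneg : ∀ x : T.domain, 0 ≤ ⟪(x : H), T x⟫_ℂ

theorem IsPosOperator.isClosed_and_dense {T : H →ₗ.[ℂ] H} (hT : IsPosOperator T) :
    T.IsClosed ∧ Dense (T.domain : Set H) :=
  ⟨hT.selfAdjoint.isClosed, hT.selfAdjoint.dense_domain⟩

/-- `S` is a positive square root of `T`: it is positive semi-definite and `S ∘ S = T`, where
`S ∘ S` has its natural domain, the set of all `x` in `Dom S` with `S x` in `Dom S`. -/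
structure IsPosSqrt (S T : H →ₗ.[ℂ] H) : Prop where
  pos : IsPosOperator S
  sq : ∀ x y : H, (x, y) ∈ T.graph ↔ ∃ z : H, (x, z) ∈ S.graph ∧ (z, y) ∈ S.graph

open scoped Classical in
/-- The square root `√T`: the positive square root of `T` (every positive semi-definite operator
has exactly one). For operators without a positive square root the value is irrelevant. -/
def opSqrt (T : H →ₗ.[ℂ] H) : H →ₗ.[ℂ] H :=
  if hT : ∃ S, IsPosSqrt S T then hT.choose else T

/-- The form `q_T(g, h) = ⟪√T g, √T h⟫` with domain `Dom √T`. -/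
def operatorForm (T : H →ₗ.[ℂ] H) : SesqForm H := SesqForm.ofOperator (opSqrt T)

end Forms

/-! ### `L`-Toeplitz forms and operators, absolutely continuous NC measures -/

/-- `L`-Toeplitz forms: positive semi-definite forms on the Fock space with dense `L`-invariant
domain such that `q(L_j g, L_k h) = δ_{jk} q(g, h)`. -/
structure IsLToeplitzForm {d : ℕ} (q : SesqForm (Fock d)) : Prop where
  posSemidef : q.IsPosSemidef
  invariant : ∀ (k : Fin d) (h : Fock d), h ∈ q.domain → leftShift d k h ∈ q.domain
  toeplitz : ∀ (j k : Fin d) (g h : q.domain),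
    q.form ⟨leftShift d j g, invariant j g g.2⟩ ⟨leftShift d k h, invariant k h h.2⟩
      = if j = k then q.form g h else 0

/-- `L`-Toeplitz operators: closed, densely defined, positive semi-definite operators `T` such
that `Dom √T` is `L`-invariant and the form `q_T` is `L`-Toeplitz. -/
structure IsLToeplitzOperator {d : ℕ} (T : Fock d →ₗ.[ℂ] Fock d) : Prop where
  pos : IsPosOperator T
  toeplitz : IsLToeplitzForm (operatorForm T)

/-- The free disk algebra, identified with the subspace `{a 1 : a ∈ A_d}` of the Fock space. -/
def diskSubspace (d : ℕ) : Submodule ℂ (Fock d) := LinearMap.range (vacuumMap d)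

/-- The identification of the subspace `{a 1 : a ∈ A_d}` with the free disk algebra. -/
def symbol (d : ℕ) : diskSubspace d ≃ₗ[ℂ] freeDiskAlgebra d :=
  (LinearEquiv.ofInjective (vacuumMap d) (vacuumMap_injective d)).symm

theorem symbol_vacuumMap {d : ℕ} (a : freeDiskAlgebra d) :
    symbol d ⟨vacuumMap d a, LinearMap.mem_range_self _ a⟩ = a :=
  (LinearEquiv.ofInjective (vacuumMap d) (vacuumMap_injective d)).symm_apply_apply a

/-- The form `q_μ(a₁, a₂) = μ(a₁^* a₂)` of an NC measure, with form domain `A_d`. -/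
def measureForm {d : ℕ} (μ : NCMeasure d) : SesqForm (Fock d) where
  domain := diskSubspace d
  form := LinearMap.mk₂'ₛₗ (starRingEnd ℂ) (RingHom.id ℂ)
    (fun x y => μ ⟨star (symbol d x : Fock d →L[ℂ] Fock d) * (symbol d y : Fock d →L[ℂ] Fock d),
      star_mul_mem_freeDiskSystem (symbol d x).2 (symbol d y).2⟩)
    (fun x x' y => by
      rw [← map_add]
      congr 1
      ext1
      simp [add_mul])
    (fun c x y => by
      rw [← map_smul]
      congr 1
      ext1
      simp)
    (fun x y y' => by
      rw [← map_add]
      congr 1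
      ext1
      simp [mul_add])
    (fun c x y => by
      rw [RingHom.id_apply, ← map_smul]
      congr 1
      ext1
      simp)

theorem measureForm_vacuumMap {d : ℕ} (μ : NCMeasure d) (a b : freeDiskAlgebra d) :
    (measureForm μ).form ⟨vacuumMap d a, LinearMap.mem_range_self _ a⟩
      ⟨vacuumMap d b, LinearMap.mem_range_self _ b⟩
      = μ ⟨star (a : Fock d →L[ℂ] Fock d) * (b : Fock d →L[ℂ] Fock d),
          star_mul_mem_freeDiskSystem a.2 b.2⟩ := by
  change μ _ = μ _
  congr 1
  ext1
  change star (symbol d ⟨vacuumMap d a, _⟩ : Fock d →L[ℂ] Fock d)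
    * (symbol d ⟨vacuumMap d b, _⟩ : Fock d →L[ℂ] Fock d) = _
  rw [symbol_vacuumMap, symbol_vacuumMap]

/-- An NC measure `μ` is absolutely continuous (with respect to NC Lebesgue measure) if the
form `q_μ` is closable. -/
def NCMeasure.IsAbsolutelyContinuous {d : ℕ} (μ : NCMeasure d) : Prop :=
  (measureForm μ).IsClosable

end NCFatou

end

open NCFatou

/-!
The operator `T` is obtained from the closure of `q_μ` by Kato's representation theorems for closed
forms, which are proved here for positive semi-definite forms on a complex Hilbert space.

Let `p` be a closed positive semi-definite form. Its domain with the inner product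
`p(g, h) + ⟪g, h⟫` is a Hilbert space (`FormSpace`), embedded in the ambient space by a contraction
`J`. The operator `T = (J J*)⁻¹ - 1` is positive and self-adjoint, and its graph consists of the
pairs `(x, y)` with `p(h, x) = ⟪h, y⟫` for all `h ∈ Dom p` (`SesqForm.exists_isAssociated`). By this
description `p` determines `T`; conversely `T` determines `p`, because `Dom T` is a core of `p`
(`SesqForm.IsAssociated.form_unique`).

To identify `p` with the form of `√T`, a positive square root has to exist. With the resolvent
`A = (1 + T)⁻¹` the operator `T` is `A w ↦ w - A w`, and `A^{1/2} w ↦ (1 - A)^{1/2} w` is a positive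
square root (`exists_isPosSqrt_pairOperator`). The form of *any* positive square root of `T` is
closed and has `T` as its associated operator, so it is `p`; uniqueness of the square root is not
needed. Hence forms of positive operators are exactly the closed forms (`exists_operatorForm_eq`),
and `T` is determined by `q_T` (`IsPosOperator.eq_of_operatorForm_eq`).

For the NC measure, `q_μ` has the `L`-Toeplitz property because `L_j* L_k = δ_{jk}`. The shifts are
therefore isometric for the form norm on `A_d`, and extend to the closure
(`isLToeplitzForm_of_isFormCore`). Finally, `A_d` is a core of the closed form by construction of
the closure, and the form norm is the graph norm of `√T`, so `A_d` is a core of `√T`.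
-/

open Filter Topology

namespace NCFatou

section Forms

variable {H : Type*} [NormedAddCommGroup H] [InnerProductSpace ℂ H]

namespace SesqForm

/-! ### The Hilbert space of a closed form -/

/-- Polarization: a form with real values `p(h, h)` is Hermitian. -/
theorem IsPosSemidef.conj_symm {p : SesqForm H} (hp : p.IsPosSemidef) (g h : p.domain) :
    starRingEnd ℂ (p.form h g) = p.form g h := by
  have him : ∀ x : p.domain, (p.form x x).im = 0 := fun x =>
    (Complex.nonneg_iff.1 (hp.nonneg x)).2.symm
  have h1 := him (g + h)
  have h2 := him (g + Complex.I • h)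
  simp only [map_add, LinearMap.add_apply, LinearMap.map_smulₛₗ, LinearMap.smul_apply,
    smul_eq_mul, Complex.conj_I, Complex.add_im, Complex.mul_im, Complex.I_re, Complex.I_im,
    Complex.neg_re, Complex.neg_im, him, Complex.add_re, Complex.mul_re, RingHom.id_apply]
    at h1 h2
  apply Complex.ext
  · simp only [Complex.conj_re]
    linarith
  · simp only [Complex.conj_im]
    linarith

/-- The inner product `p(g, h) + ⟪g, h⟫` on the domain of `p`. -/
@[reducible]
noncomputable def formCore {p : SesqForm H} (hp : p.IsPosSemidef) :
    InnerProductSpace.Core ℂ p.domain where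
  inner g h := p.form g h + ⟪(g : H), h⟫_ℂ
  conj_inner_symm g h := by
    rw [map_add, hp.conj_symm, inner_conj_symm]
  re_inner_nonneg g := by
    have h1 := (Complex.nonneg_iff.1 (hp.nonneg g)).1
    have h2 : 0 ≤ (⟪(g : H), g⟫_ℂ).re := inner_self_nonneg (𝕜 := ℂ)
    simpa using add_nonneg h1 h2
  add_left g g' h := by
    rw [map_add, LinearMap.add_apply, Submodule.coe_add, inner_add_left]
    ring
  smul_left g h c := by
    rw [LinearMap.map_smulₛₗ, LinearMap.smul_apply, Submodule.coe_smul, inner_smul_left,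
      smul_eq_mul]
    ring
  definite g hg := by
    have h1 := (Complex.nonneg_iff.1 (hp.nonneg g)).1
    have h2 : 0 ≤ (⟪(g : H), g⟫_ℂ).re := inner_self_nonneg (𝕜 := ℂ)
    have h3 := congrArg Complex.re hg
    rw [Complex.add_re, Complex.zero_re] at h3
    have h4 : RCLike.re ⟪(g : H), g⟫_ℂ = 0 := by
      change (⟪(g : H), g⟫_ℂ).re = 0
      linarith
    exact Subtype.ext (re_inner_self_nonpos.1 h4.le)

/-- The domain of a positive semi-definite form `p`, regarded as an inner product space for
`(g, h) ↦ p(g, h) + ⟪g, h⟫`; its norm is `‖·‖_{p+1}`. -/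
def FormSpace {p : SesqForm H} (_ : p.IsPosSemidef) : Type _ := p.domain

variable {p : SesqForm H} (hp : p.IsPosSemidef)

noncomputable instance : NormedAddCommGroup (FormSpace hp) := (formCore hp).toNormedAddCommGroup

noncomputable instance : InnerProductSpace ℂ (FormSpace hp) :=
  InnerProductSpace.ofCore (formCore hp).toCore

-- Makes `⟪·, ·⟫_ℂ` on `FormSpace hp` elaborate to this instance rather than to the inner product of
-- the `C⋆`-module structure over `ℂ`, which instance search would find otherwise.
noncomputable instance : Inner ℂ (FormSpace hp) := InnerProductSpace.toInner

/-- The identity map from the domain of `p`, with its inherited structure, to `FormSpace hp`. -/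
def toFormSpace : p.domain ≃ₗ[ℂ] FormSpace hp where
  toFun g := g
  invFun g := g
  map_add' _ _ := rfl
  map_smul' _ _ := rfl

theorem toFormSpace_inner (g h : p.domain) :
    ⟪toFormSpace hp g, toFormSpace hp h⟫_ℂ = p.form g h + ⟪(g : H), h⟫_ℂ := rfl

theorem toFormSpace_norm_sq (g : p.domain) : ‖toFormSpace hp g‖ ^ 2 = p.plusOneNormSq g := by
  rw [← inner_self_eq_norm_sq (𝕜 := ℂ), toFormSpace_inner, map_add, inner_self_eq_norm_sq]
  rfl

/-- The contractive embedding of the domain of `p` into the ambient space. -/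
noncomputable def embed : FormSpace hp →L[ℂ] H :=
  (p.domain.subtype ∘ₗ (toFormSpace hp).symm.toLinearMap).mkContinuous 1 fun g => by
    obtain ⟨g, rfl⟩ := (toFormSpace hp).surjective g
    have h1 := toFormSpace_norm_sq hp g
    have h2 := (Complex.nonneg_iff.1 (hp.nonneg g)).1
    rw [one_mul]
    refine le_of_sq_le_sq ?_ (norm_nonneg _)
    rw [h1]
    exact le_add_of_nonneg_left h2

theorem embed_injective : Function.Injective (embed hp) := Subtype.val_injective

theorem embed_mem (g : FormSpace hp) : embed hp g ∈ p.domain := Subtype.property _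

theorem toFormSpace_embed (g : FormSpace hp) :
    toFormSpace hp ⟨embed hp g, embed_mem hp g⟩ = g := rfl

theorem denseRange_embed : DenseRange (embed hp) := by
  refine hp.dense.mono fun x hx => ⟨toFormSpace hp ⟨x, hx⟩, rfl⟩

theorem form_eq_inner_sub (g h : p.domain) :
    p.form g h = ⟪toFormSpace hp g, toFormSpace hp h⟫_ℂ - ⟪(g : H), h⟫_ℂ :=
  (add_sub_cancel_right _ _).symm

theorem tendsto_toFormSpace_iff (u : ℕ → p.domain) (g : p.domain) :
    Tendsto (fun n => toFormSpace hp (u n)) atTop (𝓝 (toFormSpace hp g)) ↔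
      Tendsto (fun n => p.plusOneNormSq (u n - g)) atTop (𝓝 0) := by
  rw [tendsto_iff_norm_sub_tendsto_zero]
  simp only [← toFormSpace_norm_sq hp, map_sub]
  refine ⟨fun h => by simpa using h.pow 2, fun h => ?_⟩
  simpa using h.sqrt

theorem cauchySeq_toFormSpace_iff (u : ℕ → p.domain) :
    CauchySeq (fun n => toFormSpace hp (u n)) ↔ ∀ ε : ℝ, 0 < ε → ∃ N, ∀ m n, N ≤ m → N ≤ n →
      p.plusOneNormSq (u m - u n) < ε := by
  simp only [← toFormSpace_norm_sq hp, map_sub, Metric.cauchySeq_iff, dist_eq_norm]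
  constructor
  · intro hu ε hε
    obtain ⟨N, hN⟩ := hu (√ε) (Real.sqrt_pos.2 hε)
    exact ⟨N, fun m n hm hn => (Real.lt_sqrt (norm_nonneg _)).1 (hN m hm n hn)⟩
  · intro hu ε hε
    obtain ⟨N, hN⟩ := hu (ε ^ 2) (by positivity)
    exact ⟨N, fun m hm n hn => lt_of_pow_lt_pow_left₀ 2 hε.le (hN m n hm hn)⟩

theorem IsClosed.completeSpace (hc : p.IsClosed) : CompleteSpace (FormSpace hp) := by
  refine Metric.complete_of_cauchySeq_tendsto fun u hu => ?_
  obtain ⟨h, hh⟩ := hc (fun n => (toFormSpace hp).symm (u n))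
    ((cauchySeq_toFormSpace_iff hp _).1 (by simpa using hu))
  exact ⟨toFormSpace hp h, by simpa using (tendsto_toFormSpace_iff hp _ h).2 hh⟩

/-- A subspace `D` of the ambient space is a core of the form `p` if its elements in the domain
of `p` are dense for the norm `‖·‖_{p+1}`. -/
def IsFormCore (D : Submodule ℂ H) : Prop :=
  Dense {g : FormSpace hp | embed hp g ∈ D}

/-! ### Closures of forms -/

theorem IsExtendedBy.antisymm {p r : SesqForm H} (h : p.IsExtendedBy r) (h' : r.IsExtendedBy p) :
    p = r := by
  obtain ⟨h1, h2⟩ := h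
  obtain ⟨h3, -⟩ := h'
  obtain ⟨Dp, fp⟩ := p
  obtain ⟨Dr, fr⟩ := r
  obtain rfl : Dp = Dr := le_antisymm h1 h3
  congr
  exact LinearMap.ext fun g => LinearMap.ext fun h => (h2 g h).symm

theorem IsClosure.unique {q p r : SesqForm H} (hp : q.IsClosure p) (hr : q.IsClosure r) : p = r :=
  (hp.minimal r hr.posSemidef hr.closed hr.extends_form).antisymm
    (hr.minimal p hp.posSemidef hp.closed hp.extends_form)

/-- Two forms extending `q` have the same inner products `⟪·, ·⟫_{·+1}` on the domain of `q`. -/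
theorem inner_eq_of_isExtendedBy {q p r : SesqForm H} {hp : p.IsPosSemidef} {hr : r.IsPosSemidef}
    (hqp : q.IsExtendedBy p) (hqr : q.IsExtendedBy r) {g h : FormSpace hp} {g' h' : FormSpace hr}
    (hg : embed hp g ∈ q.domain) (hh : embed hp h ∈ q.domain)
    (hgg : embed hr g' = embed hp g) (hhh : embed hr h' = embed hp h) :
    ⟪g', h'⟫_ℂ = ⟪g, h⟫_ℂ := by
  obtain ⟨h1, h2⟩ := hqp
  obtain ⟨h3, h4⟩ := hqr
  have e1 := h2 ⟨_, hg⟩ ⟨_, hh⟩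
  have e2 := h4 ⟨_, hg⟩ ⟨_, hh⟩
  have eg : g' = toFormSpace hr ⟨embed hp g, h3 hg⟩ := embed_injective hr hgg
  have eh : h' = toFormSpace hr ⟨embed hp h, h3 hh⟩ := embed_injective hr hhh
  rw [eg, eh, toFormSpace_inner, e2, ← e1]
  exact (toFormSpace_inner hp ⟨embed hp g, h1 hg⟩ ⟨embed hp h, h1 hh⟩).symm

/-- A closed form is the closure of each of its restrictions to a core: approximating sequences
from the core are Cauchy for any other closed extension, and the limits agree in the ambient
space. -/
theorem isClosure_of_isFormCore {q : SesqForm H} (hc : p.IsClosed) (hqp : q.IsExtendedBy p)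
    (hD : IsFormCore hp q.domain) : q.IsClosure p := by
  refine ⟨hp, hc, hqp, fun r hr hrc hqr => ?_⟩
  have := hrc.completeSpace hr
  have key : ∀ h : FormSpace hp, ∃ (h' : FormSpace hr) (u : ℕ → FormSpace hp)
      (v : ℕ → FormSpace hr), Tendsto u atTop (𝓝 h) ∧ Tendsto v atTop (𝓝 h') ∧
      (∀ n, embed hp (u n) ∈ q.domain) ∧ (∀ n, embed hr (v n) = embed hp (u n)) ∧
      embed hr h' = embed hp h := by
    intro h
    obtain ⟨u, hu, hlim⟩ := mem_closure_iff_seq_limit.1 (hD h)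
    let v : ℕ → FormSpace hr := fun n => toFormSpace hr ⟨embed hp (u n), hqr.1 (hu n)⟩
    have hv : ∀ n, embed hr (v n) = embed hp (u n) := fun n => rfl
    have hdist : ∀ m n, ‖v m - v n‖ = ‖u m - u n‖ := by
      intro m n
      have hmem : embed hp (u m - u n) ∈ q.domain := by
        rw [map_sub]
        exact q.domain.sub_mem (hu m) (hu n)
      have he : embed hr (v m - v n) = embed hp (u m - u n) := by
        rw [map_sub, map_sub, hv, hv]
      rw [@norm_eq_sqrt_re_inner ℂ, @norm_eq_sqrt_re_inner ℂ (FormSpace hp),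
        inner_eq_of_isExtendedBy hqp hqr hmem hmem he he]
    have hcau : CauchySeq v := by
      have := hlim.cauchySeq
      rw [Metric.cauchySeq_iff] at this ⊢
      simpa only [dist_eq_norm, hdist] using this
    obtain ⟨h', hh'⟩ := cauchySeq_tendsto_of_complete hcau
    refine ⟨h', u, v, hlim, hh', hu, hv, ?_⟩
    have e1 := ((embed hr).continuous.tendsto h').comp hh'
    have e2 := ((embed hp).continuous.tendsto h).comp hlim
    exact tendsto_nhds_unique e1 e2
  have hle : p.domain ≤ r.domain := by
    intro x hx
    obtain ⟨h', -, -, -, -, -, -, he⟩ := key (toFormSpace hp ⟨x, hx⟩)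
    have : x = embed hr h' := he.symm
    exact this ▸ embed_mem hr h'
  refine ⟨hle, fun g h => ?_⟩
  obtain ⟨g', u, v, hu, hv, hum, huv, hg⟩ := key (toFormSpace hp g)
  obtain ⟨h', u', v', hu', hv', hum', huv', hh⟩ := key (toFormSpace hp h)
  have e1 := hu.inner (𝕜 := ℂ) hu'
  have e2 := hv.inner (𝕜 := ℂ) hv'
  have e3 : ⟪g', h'⟫_ℂ = ⟪toFormSpace hp g, toFormSpace hp h⟫_ℂ := by
    refine tendsto_nhds_unique e2 (e1.congr fun n => ?_)
    exact (inner_eq_of_isExtendedBy hqp hqr (hum n) (hum' n) (huv n) (huv' n)).symm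
  have eg : toFormSpace hr ⟨g, hle g.2⟩ = g' := embed_injective hr hg.symm
  have eh : toFormSpace hr ⟨h, hle h.2⟩ = h' := embed_injective hr hh.symm
  rw [form_eq_inner_sub hr, eg, eh, e3, form_eq_inner_sub hp]

/-- The restriction of a form to a smaller domain. -/
def restrict (p : SesqForm H) (D : Submodule ℂ H) (hD : D ≤ p.domain) : SesqForm H where
  domain := D
  form := (p.form.comp (Submodule.inclusion hD)).compl₂ (Submodule.inclusion hD)

theorem restrict_isExtendedBy (p : SesqForm H) (D : Submodule ℂ H) (hD : D ≤ p.domain) :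
    (p.restrict D hD).IsExtendedBy p := ⟨hD, fun _ _ => rfl⟩

/-- A closable form with dense domain has a closure, and its domain is a core of the closure. The
closure is the restriction of a closed extension `r` to the closure of the domain of `q` in
`‖·‖_{r+1}`. -/
theorem IsClosable.exists_isClosure {q : SesqForm H} (hq : q.IsClosable)
    (hd : Dense (q.domain : Set H)) :
    ∃ (p : SesqForm H) (hp : p.IsPosSemidef), q.IsClosure p ∧ IsFormCore hp q.domain := by
  obtain ⟨r, hr, hrc, hqr⟩ := hq
  have := hrc.completeSpace hr
  let D₀ : Submodule ℂ (FormSpace hr) := q.domain.comap (embed hr).toLinearMap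
  let D : Submodule ℂ H := D₀.topologicalClosure.map (embed hr).toLinearMap
  have hDr : D ≤ r.domain := by
    rintro _ ⟨g, -, rfl⟩
    exact embed_mem hr g
  have hmem : ∀ g : FormSpace hr, embed hr g ∈ D → g ∈ D₀.topologicalClosure := by
    rintro g ⟨g', hg', he⟩
    exact embed_injective hr he ▸ hg'
  have hqD : q.domain ≤ D := fun x hx =>
    ⟨toFormSpace hr ⟨x, hqr.1 hx⟩, Submodule.le_topologicalClosure _ (show x ∈ q.domain from hx),
      rfl⟩
  let p := r.restrict D hDr
  have hp : p.IsPosSemidef := ⟨hd.mono hqD, fun h => hr.nonneg ⟨h, hDr h.2⟩⟩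
  have hqp : q.IsExtendedBy p := ⟨hqD, fun g h => hqr.2 g h⟩
  have hN : ∀ x y : p.domain, p.plusOneNormSq (x - y) =
      r.plusOneNormSq ((⟨x, hDr x.2⟩ : r.domain) - ⟨y, hDr y.2⟩) := fun x y => rfl
  have hpc : p.IsClosed := by
    intro u hu
    let v : ℕ → r.domain := fun n => ⟨u n, hDr (u n).2⟩
    simp only [hN] at hu ⊢
    obtain ⟨h, hh⟩ := cauchySeq_tendsto_of_complete ((cauchySeq_toFormSpace_iff hr v).2 hu)
    have hhD : h ∈ D₀.topologicalClosure :=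
      D₀.isClosed_topologicalClosure.mem_of_tendsto hh
        (Eventually.of_forall fun n => hmem (toFormSpace hr (v n)) (u n).2)
    rw [← toFormSpace_embed hr h, tendsto_toFormSpace_iff] at hh
    exact ⟨⟨embed hr h, ⟨h, hhD, rfl⟩⟩, hh⟩
  have hcore : IsFormCore hp q.domain := by
    intro g
    obtain ⟨v, hv, hlim⟩ := mem_closure_iff_seq_limit.1
      (hmem (toFormSpace hr ⟨embed hp g, hDr (embed_mem hp g)⟩) (embed_mem hp g))
    let w : ℕ → p.domain := fun n => ⟨embed hr (v n), hqD (hv n)⟩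
    refine mem_closure_iff_seq_limit.2 ⟨fun n => toFormSpace hp (w n), hv, ?_⟩
    rw [← toFormSpace_embed hp g, tendsto_toFormSpace_iff]
    simp only [hN]
    rw [← tendsto_toFormSpace_iff hr]
    exact hlim
  exact ⟨p, hp, isClosure_of_isFormCore hp hpc hqp hcore, hcore⟩

end SesqForm

end Forms

section Operators

variable {H : Type*} [NormedAddCommGroup H] [InnerProductSpace ℂ H]

/-! ### Operators parametrized by pairs of bounded operators -/

/-- The operator `B w ↦ C w` with domain the range of `B`, for bounded operators `B` and `C`. It is
meaningful only when `B w = 0` implies `C w = 0`, for instance when `B` is injective. -/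
noncomputable def pairOperator (B C : H →L[ℂ] H) : H →ₗ.[ℂ] H :=
  (LinearMap.range (B.toLinearMap.prod C.toLinearMap)).toLinearPMap

theorem mem_graph_pairOperator {B C : H →L[ℂ] H} (hB : Function.Injective B) {x y : H} :
    (x, y) ∈ (pairOperator B C).graph ↔ ∃ w, B w = x ∧ C w = y := by
  rw [pairOperator, Submodule.toLinearPMap_graph_eq]
  · simp
  · rintro _ ⟨w, rfl⟩ hw
    have hw : B w = 0 := hw
    obtain rfl : w = 0 := hB (by rw [hw, map_zero])
    simp

theorem mem_domain_of_mem_graph {T : H →ₗ.[ℂ] H} {x y : H} (h : (x, y) ∈ T.graph) :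
    ∃ hx : x ∈ T.domain, T ⟨x, hx⟩ = y := by
  obtain ⟨⟨x', hx'⟩, h1, h2⟩ := (LinearPMap.mem_graph_iff T).1 h
  obtain rfl : x' = x := h1
  exact ⟨hx', h2⟩

theorem inner_self_complex_nonneg (v : H) : 0 ≤ ⟪v, v⟫_ℂ := by
  rw [inner_self_eq_norm_sq_to_K]
  exact pow_nonneg (Complex.zero_le_real.2 (norm_nonneg v)) 2

theorem nonneg_of_forall_inner_nonneg {X : H →L[ℂ] H} (hX : ∀ w, 0 ≤ ⟪X w, w⟫_ℂ) : 0 ≤ X := by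
  rw [ContinuousLinearMap.nonneg_iff_isPositive, ContinuousLinearMap.isPositive_iff_complex]
  intro w
  obtain ⟨h1, h2⟩ := Complex.nonneg_iff.1 (hX w)
  exact ⟨Complex.ext rfl h2, h1⟩

/-- A bounded operator `A` with `0 ≤ ⟪A w, w - A w⟫` is a positive contraction. -/
theorem nonneg_and_one_sub_nonneg {A : H →L[ℂ] H} (hA : ∀ w, 0 ≤ ⟪A w, w - A w⟫_ℂ) :
    0 ≤ A ∧ 0 ≤ 1 - A := by
  constructor
  · refine nonneg_of_forall_inner_nonneg fun w => ?_
    have h : ⟪A w, w⟫_ℂ = ⟪A w, w - A w⟫_ℂ + ⟪A w, A w⟫_ℂ := by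
      rw [← inner_add_right, sub_add_cancel]
    rw [h]
    exact add_nonneg (hA w) (inner_self_complex_nonneg _)
  · refine nonneg_of_forall_inner_nonneg fun w => ?_
    have h : ⟪(1 - A) w, w⟫_ℂ
        = ⟪w - A w, w - A w⟫_ℂ + starRingEnd ℂ ⟪A w, w - A w⟫_ℂ := by
      rw [inner_conj_symm, ← inner_add_right, sub_add_cancel]
      rfl
    rw [h, Complex.conj_eq_iff_im.2 (Complex.nonneg_iff.1 (hA w)).2.symm]
    exact add_nonneg (inner_self_complex_nonneg _) (hA w)

variable [CompleteSpace H]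

/-- The graph of a self-adjoint operator is its own adjoint relation. -/
theorem mem_graph_iff_of_isSelfAdjoint {T : H →ₗ.[ℂ] H} (hT : IsSelfAdjoint T) {y z : H} :
    (y, z) ∈ T.graph ↔ ∀ a : T.domain, ⟪T a, y⟫_ℂ = ⟪(a : H), z⟫_ℂ := by
  have h1 : T.graph = T.graph.adjoint := by
    conv_lhs => rw [← LinearPMap.isSelfAdjoint_def.1 hT]
    exact LinearPMap.adjoint_graph_eq_graph_adjoint hT.dense_domain
  rw [h1, Submodule.mem_adjoint_iff]
  constructor
  · intro h a
    exact sub_eq_zero.1 (h a (T a) (T.mem_graph a))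
  · rintro h a b hab
    obtain ⟨ha, rfl⟩ := mem_domain_of_mem_graph hab
    exact sub_eq_zero.2 (h ⟨a, ha⟩)

/-- Commuting self-adjoint `B` and `C` give a symmetric operator `B w ↦ C w`; the condition `hmax`
says that its graph already contains the graph of its adjoint. -/
theorem isPosOperator_pairOperator {B C : H →L[ℂ] H} (hBs : IsSelfAdjoint B)
    (hCs : IsSelfAdjoint C) (hB : Function.Injective B) (hpos : ∀ w, 0 ≤ ⟪B w, C w⟫_ℂ)
    (hcomm : ∀ w, B (C w) = C (B w))
    (hmax : ∀ y z, B z = C y → ∃ w, B w = y ∧ C w = z) :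
    IsPosOperator (pairOperator B C) := by
  have hBi : ∀ x y, ⟪B x, y⟫_ℂ = ⟪x, B y⟫_ℂ := hBs.isSymmetric
  have hCi : ∀ x y, ⟪C x, y⟫_ℂ = ⟪x, C y⟫_ℂ := hCs.isSymmetric
  have hdense : Dense ((pairOperator B C).domain : Set H) := by
    rw [Submodule.dense_iff_topologicalClosure_eq_top,
      Submodule.topologicalClosure_eq_top_iff, Submodule.eq_bot_iff]
    intro v hv
    refine hB ?_
    rw [map_zero]
    refine ext_inner_left ℂ fun w => ?_
    rw [← hBi, inner_zero_right]
    obtain ⟨hx, -⟩ := mem_domain_of_mem_graph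
      ((mem_graph_pairOperator (C := C) hB).2 ⟨w, rfl, rfl⟩)
    exact (Submodule.mem_orthogonal _ _).1 hv _ hx
  refine ⟨?_, ?_⟩
  · rw [LinearPMap.isSelfAdjoint_def]
    refine LinearPMap.eq_of_eq_graph ?_
    rw [LinearPMap.adjoint_graph_eq_graph_adjoint hdense]
    ext ⟨y, z⟩
    rw [Submodule.mem_adjoint_iff, mem_graph_pairOperator hB]
    constructor
    · intro h
      refine hmax y z (ext_inner_left ℂ fun w => ?_)
      have := h (B w) (C w) ((mem_graph_pairOperator hB).2 ⟨w, rfl, rfl⟩)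
      rw [sub_eq_zero] at this
      rw [← hBi, ← hCi]
      exact this.symm
    · rintro ⟨w, rfl, rfl⟩ a b hab
      obtain ⟨v, rfl, rfl⟩ := (mem_graph_pairOperator hB).1 hab
      change ⟪C v, B w⟫_ℂ - ⟪B v, C w⟫_ℂ = 0
      rw [hBi, hCi, hcomm, sub_self]
  · intro x
    obtain ⟨w, h1, h2⟩ := (mem_graph_pairOperator hB).1 ((pairOperator B C).mem_graph x)
    rw [← h1, ← h2]
    exact hpos w

/-! ### Resolvents and square roots -/

/-- If `A` is the resolvent `(1 + T)⁻¹`, then `√T = (1 - A)^{1/2} A^{-1/2}`. -/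
theorem exists_isPosSqrt_pairOperator {A : H →L[ℂ] H} (hinj : Function.Injective A)
    (hA : ∀ w, 0 ≤ ⟪A w, w - A w⟫_ℂ) : ∃ S, IsPosSqrt S (pairOperator A (1 - A)) := by
  obtain ⟨h0, h1⟩ := nonneg_and_one_sub_nonneg hA
  set B := CFC.sqrt A with hBdef
  set C := CFC.sqrt (1 - A) with hCdef
  have hB0 : 0 ≤ B := CFC.sqrt_nonneg A
  have hC0 : 0 ≤ C := CFC.sqrt_nonneg _
  have hcomm : Commute B C := by
    have h2 : Commute A (1 - A) := (Commute.one_right A).sub_right (Commute.refl A)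
    exact (h2.cfcₙ_nnreal _).symm.cfcₙ_nnreal _ |>.symm
  have hBC0 : 0 ≤ B * C := hcomm.mul_nonneg hB0 hC0
  have hBB : ∀ w, B (B w) = A w := fun w =>
    congrArg (fun X : H →L[ℂ] H => X w) (CFC.sqrt_mul_sqrt_self A h0)
  have hCC : ∀ w, C (C w) = w - A w := fun w =>
    congrArg (fun X : H →L[ℂ] H => X w) (CFC.sqrt_mul_sqrt_self (1 - A) h1)
  have hBC : ∀ w, B (C w) = C (B w) := fun w => congrArg (fun X : H →L[ℂ] H => X w) hcomm.eq
  have hB : Function.Injective B := fun x y hxy => hinj (by rw [← hBB, ← hBB, hxy])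
  have hBs : IsSelfAdjoint B := IsSelfAdjoint.of_nonneg hB0
  have hCs : IsSelfAdjoint C := IsSelfAdjoint.of_nonneg hC0
  -- `w = B y + C z` is the parameter because `B² + C² = 1`
  have hmax : ∀ y z, B z = C y → ∃ w, B w = y ∧ C w = z := by
    intro y z h
    refine ⟨B y + C z, ?_, ?_⟩
    · rw [map_add, hBB, hBC, h, hCC, add_sub_cancel]
    · rw [map_add, hCC, ← hBC, ← h, hBB, add_sub_cancel]
  refine ⟨pairOperator B C, isPosOperator_pairOperator hBs hCs hB ?_ hBC hmax, fun x y => ?_⟩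
  · intro w
    rw [ContinuousLinearMap.nonneg_iff_isPositive] at hBC0
    have h2 := hBC0.inner_nonneg_right w
    have h3 : ⟪B w, C w⟫_ℂ = ⟪w, (B * C) w⟫_ℂ := hBs.isSymmetric w (C w)
    rw [h3]
    exact h2
  · simp only [mem_graph_pairOperator hinj, mem_graph_pairOperator hB]
    constructor
    · rintro ⟨w, rfl, rfl⟩
      exact ⟨B (C w), ⟨B w, hBB w, (hBC w).symm⟩, ⟨C w, rfl, hCC w⟩⟩
    · rintro ⟨z, ⟨u, rfl, hu⟩, ⟨v, hv, rfl⟩⟩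
      obtain ⟨w, rfl, rfl⟩ := hmax u v (hv.trans hu.symm)
      exact ⟨w, (hBB w).symm, (hCC w).symm⟩

theorem isPosOperator_pairOperator_one_sub {A : H →L[ℂ] H} (hinj : Function.Injective A)
    (hA : ∀ w, 0 ≤ ⟪A w, w - A w⟫_ℂ) : IsPosOperator (pairOperator A (1 - A)) := by
  obtain ⟨h0, h1⟩ := nonneg_and_one_sub_nonneg hA
  refine isPosOperator_pairOperator (IsSelfAdjoint.of_nonneg h0) (IsSelfAdjoint.of_nonneg h1) hinj
    hA (fun w => ?_) (fun y z h => ?_)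
  · change A (w - A w) = A w - A (A w)
    rw [map_sub]
  · change A z = y - A y at h
    have h2 : A (y + z) = y := by rw [map_add, h, add_sub_cancel]
    refine ⟨y + z, h2, ?_⟩
    change y + z - A (y + z) = z
    rw [h2, add_sub_cancel_left]

/-- Every positive self-adjoint operator `T` is `A w ↦ w - A w` for its resolvent
`A = (1 + T)⁻¹`. -/
theorem IsPosOperator.exists_resolvent {T : H →ₗ.[ℂ] H} (hT : IsPosOperator T) :
    ∃ A : H →L[ℂ] H, Function.Injective A ∧ (∀ w, 0 ≤ ⟪A w, w - A w⟫_ℂ) ∧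
      T = pairOperator A (1 - A) := by
  set G := T.graph with hG
  have hpos : ∀ g : G, 0 ≤ ⟪(g : H × H).1, (g : H × H).2⟫_ℂ := by
    rintro ⟨⟨x, y⟩, hxy⟩
    obtain ⟨hx, rfl⟩ := mem_domain_of_mem_graph hxy
    exact hT.nonneg ⟨x, hx⟩
  let Φ : G →L[ℂ] H :=
    (ContinuousLinearMap.fst ℂ H H + ContinuousLinearMap.snd ℂ H H).comp G.subtypeL
  have hΦ : ∀ g : G, Φ g = (g : H × H).1 + (g : H × H).2 := fun g => rfl
  have hsq : ∀ g : G, ‖(g : H × H).1‖ ^ 2 + ‖(g : H × H).2‖ ^ 2 ≤ ‖Φ g‖ ^ 2 := by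
    intro g
    rw [hΦ, @norm_add_sq ℂ]
    have h1 : 0 ≤ RCLike.re ⟪(g : H × H).1, (g : H × H).2⟫_ℂ :=
      (Complex.nonneg_iff.1 (hpos g)).1
    linarith
  have h1 : ∀ g : G, ‖(g : H × H).1‖ ≤ ‖Φ g‖ := fun g =>
    le_of_sq_le_sq ((le_add_of_nonneg_right (sq_nonneg _)).trans (hsq g)) (norm_nonneg _)
  have h2 : ∀ g : G, ‖(g : H × H).2‖ ≤ ‖Φ g‖ := fun g =>
    le_of_sq_le_sq ((le_add_of_nonneg_left (sq_nonneg _)).trans (hsq g)) (norm_nonneg _)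
  have hanti : AntilipschitzWith 1 Φ :=
    AddMonoidHomClass.antilipschitz_of_bound Φ fun g => by
      rw [NNReal.coe_one, one_mul]
      exact max_le (h1 g) (h2 g)
  have hGclosed : IsClosed (G : Set (H × H)) := hT.isClosed_and_dense.1
  have hGc : CompleteSpace G := hGclosed.completeSpace_coe
  have hrange : IsClosed (LinearMap.range Φ.toLinearMap : Set H) :=
    hanti.isClosed_range Φ.uniformContinuous
  have htop : LinearMap.range Φ.toLinearMap = ⊤ := by
    have := hrange.completeSpace_coe
    rw [← Submodule.orthogonal_eq_bot_iff, Submodule.eq_bot_iff]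
    intro v hv
    -- `v` is orthogonal to all `x + T x`, so `T v = -v`
    have hv' : (v, -v) ∈ G := by
      rw [hG, mem_graph_iff_of_isSelfAdjoint hT.selfAdjoint]
      intro a
      have h3 := (Submodule.mem_orthogonal _ _).1 hv _ ⟨⟨(a, T a), T.mem_graph a⟩, rfl⟩
      have h4 : ⟪(a : H) + T a, v⟫_ℂ = 0 := h3
      rw [inner_add_left] at h4
      rw [inner_neg_right]
      exact eq_neg_of_add_eq_zero_right h4
    have h3 : 0 ≤ ⟪v, -v⟫_ℂ := hpos ⟨_, hv'⟩
    rw [inner_neg_right] at h3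
    have h4 : ⟪v, v⟫_ℂ = 0 := le_antisymm (neg_nonneg.1 h3) (inner_self_complex_nonneg v)
    exact inner_self_eq_zero.1 h4
  let e : G ≃ₗ[ℂ] H := LinearEquiv.ofBijective Φ.toLinearMap
    ⟨hanti.injective, LinearMap.range_eq_top.1 htop⟩
  have he : ∀ w, Φ (e.symm w) = w := fun w => e.apply_symm_apply w
  let A : H →L[ℂ] H := (LinearMap.fst ℂ H H ∘ₗ G.subtype ∘ₗ e.symm.toLinearMap).mkContinuous 1
    fun w => by
      rw [one_mul]
      have := h1 (e.symm w)
      rwa [he] at this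
  have hA1 : ∀ w, A w = (e.symm w : H × H).1 := fun w => rfl
  have hA2 : ∀ w, w - A w = (e.symm w : H × H).2 := fun w => by
    have := he w
    rw [hΦ] at this
    rw [hA1, sub_eq_iff_eq_add']
    exact this.symm
  have hgraph : ∀ w, (A w, w - A w) ∈ G := fun w => by
    rw [hA2, hA1]
    exact (e.symm w).2
  have hinj : Function.Injective A := by
    rw [injective_iff_map_eq_zero]
    intro w hw
    have h3 := hgraph w
    rw [hw, sub_zero] at h3
    exact LinearPMap.graph_fst_eq_zero_snd T h3 rfl
  refine ⟨A, hinj, fun w => hpos ⟨_, hgraph w⟩, LinearPMap.eq_of_eq_graph ?_⟩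
  ext ⟨x, y⟩
  rw [mem_graph_pairOperator hinj]
  constructor
  · intro hxy
    have h3 : e ⟨(x, y), hxy⟩ = x + y := rfl
    have h4 : A (x + y) = x := by
      rw [hA1, ← h3, e.symm_apply_apply]
    refine ⟨x + y, h4, ?_⟩
    change x + y - A (x + y) = y
    rw [h4, add_sub_cancel_left]
  · rintro ⟨w, rfl, rfl⟩
    exact hgraph w

theorem IsPosOperator.isPosSqrt_opSqrt {T : H →ₗ.[ℂ] H} (hT : IsPosOperator T) :
    IsPosSqrt (opSqrt T) T := by
  obtain ⟨A, hinj, hA, rfl⟩ := hT.exists_resolvent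
  have h := exists_isPosSqrt_pairOperator hinj hA
  rw [opSqrt, dif_pos h]
  exact h.choose_spec

end Operators

/-! ### The operator associated with a closed form -/

section AssociatedOperator

variable {H : Type*} [NormedAddCommGroup H] [InnerProductSpace ℂ H]

namespace SesqForm

/-- The operator `T` is associated with the form `p`: its graph consists of all `(x, y)` with
`x ∈ Dom p` and `p(h, x) = ⟪h, y⟫` for every `h ∈ Dom p`. -/
def IsAssociated (p : SesqForm H) (T : H →ₗ.[ℂ] H) : Prop :=
  ∀ x y : H, (x, y) ∈ T.graph ↔
    ∃ hx : x ∈ p.domain, ∀ h : p.domain, p.form h ⟨x, hx⟩ = ⟪(h : H), y⟫_ℂ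

theorem IsAssociated.unique {p : SesqForm H} {T T' : H →ₗ.[ℂ] H} (h : p.IsAssociated T)
    (h' : p.IsAssociated T') : T = T' := by
  refine LinearPMap.eq_of_eq_graph ?_
  ext ⟨x, y⟩
  rw [h, h']

theorem isPosSemidef_ofOperator {S : H →ₗ.[ℂ] H} (hS : Dense (S.domain : Set H)) :
    (ofOperator S).IsPosSemidef :=
  ⟨hS, fun h => inner_self_complex_nonneg (S h)⟩

theorem plusOneNormSq_ofOperator (S : H →ₗ.[ℂ] H) (h : S.domain) :
    (ofOperator S).plusOneNormSq h = ‖S h‖ ^ 2 + ‖(h : H)‖ ^ 2 := by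
  rw [← inner_self_eq_norm_sq (𝕜 := ℂ) (S h)]
  rfl

/-- If `T` is associated with `p` and `1 + T` is onto, then the domain of `T` is a core of `p`: a
vector `z` orthogonal to it for `⟪·, ·⟫_{p+1}` is orthogonal to the range of `1 + T`. -/
theorem IsAssociated.isFormCore {p : SesqForm H} (hp : p.IsPosSemidef) (hc : p.IsClosed)
    {T : H →ₗ.[ℂ] H} (h : p.IsAssociated T) (hT : ∀ w, ∃ x : T.domain, (x : H) + T x = w) :
    IsFormCore hp T.domain := by
  have := hc.completeSpace hp
  let M : Submodule ℂ (FormSpace hp) := T.domain.comap (embed hp).toLinearMap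
  suffices hM : M.topologicalClosure = ⊤ from
    Submodule.dense_iff_topologicalClosure_eq_top.2 hM
  rw [Submodule.topologicalClosure_eq_top_iff, Submodule.eq_bot_iff]
  intro z hz
  obtain ⟨x, hx⟩ := hT (embed hp z)
  obtain ⟨hxp, hform⟩ := (h x (T x)).1 (T.mem_graph x)
  have h1 : ⟪z, toFormSpace hp ⟨x, hxp⟩⟫_ℂ = 0 :=
    (Submodule.mem_orthogonal' _ _).1 hz _ (show embed hp _ ∈ T.domain from x.2)
  rw [← toFormSpace_embed hp z, toFormSpace_inner, hform, ← inner_add_right, add_comm (T x), hx,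
    inner_self_eq_zero] at h1
  exact embed_injective hp ((show embed hp z = 0 from h1).trans (map_zero _).symm)

/-- A closed form is determined by its associated operator `T`, if `1 + T` is onto. -/
theorem IsAssociated.form_unique {p r : SesqForm H} (hp : p.IsPosSemidef) (hpc : p.IsClosed)
    (hr : r.IsPosSemidef) (hrc : r.IsClosed) {T : H →ₗ.[ℂ] H} (h : p.IsAssociated T)
    (h' : r.IsAssociated T) (hT : ∀ w, ∃ x : T.domain, (x : H) + T x = w) : p = r := by
  have hTp : T.domain ≤ p.domain := fun x hx => ((h x _).1 (T.mem_graph ⟨x, hx⟩)).1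
  have hTr : T.domain ≤ r.domain := fun x hx => ((h' x _).1 (T.mem_graph ⟨x, hx⟩)).1
  have h1 : (p.restrict T.domain hTp).IsClosure p :=
    isClosure_of_isFormCore hp hpc (restrict_isExtendedBy _ _ _) (h.isFormCore hp hpc hT)
  refine h1.unique (isClosure_of_isFormCore hr hrc ⟨hTr, fun x y => ?_⟩ (h'.isFormCore hr hrc hT))
  obtain ⟨hx, hform⟩ := (h y (T y)).1 (T.mem_graph y)
  obtain ⟨hx', hform'⟩ := (h' y (T y)).1 (T.mem_graph y)
  exact (hform' ⟨x, hTr x.2⟩).trans (hform ⟨x, hTp x.2⟩).symm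

/-- A core of the form `⟪S g, S h⟫` is a core of the closed operator `S`. -/
theorem IsFormCore.hasCore {S : H →ₗ.[ℂ] H} (hS : S.IsClosed) {hp : (ofOperator S).IsPosSemidef}
    {D : Submodule ℂ H} (hle : D ≤ S.domain) (hD : IsFormCore hp D) : S.HasCore D := by
  refine ⟨hle, LinearPMap.eq_of_eq_graph ?_⟩
  have hres : S.domRestrict D ≤ S := LinearPMap.domRestrict_le
  have hcl : (S.domRestrict D).IsClosable := hS.isClosable.leIsClosable hres
  rw [← hcl.graph_closure_eq_closure_graph]
  refine le_antisymm (Submodule.topologicalClosure_minimal _ (LinearPMap.le_graph_of_le hres) hS) ?_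
  rintro ⟨x, y⟩ hxy
  obtain ⟨hx, rfl⟩ := mem_domain_of_mem_graph hxy
  obtain ⟨u, hu, hlim⟩ := mem_closure_iff_seq_limit.1 (hD (toFormSpace hp ⟨x, hx⟩))
  let v : ℕ → S.domain := fun n => ⟨embed hp (u n), embed_mem hp (u n)⟩
  have h1 : Tendsto (fun n => ‖S (v n) - S ⟨x, hx⟩‖ ^ 2 + ‖(v n : H) - x‖ ^ 2) atTop (𝓝 0) := by
    refine ((tendsto_toFormSpace_iff hp v ⟨x, hx⟩).1 hlim).congr fun n => ?_
    rw [← S.map_sub]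
    exact plusOneNormSq_ofOperator S (v n - ⟨x, hx⟩)
  have hsq : ∀ w : ℕ → H, Tendsto (fun n => ‖w n‖ ^ 2) atTop (𝓝 0) →
      Tendsto (fun n => ‖w n‖) atTop (𝓝 0) := fun w hw => by simpa using hw.sqrt
  have h2 : Tendsto (fun n => (v n : H)) atTop (𝓝 x) :=
    tendsto_iff_norm_sub_tendsto_zero.2 (hsq _ (squeeze_zero (fun n => sq_nonneg _)
      (fun n => le_add_of_nonneg_left (sq_nonneg _)) h1))
  have h3 : Tendsto (fun n => S (v n)) atTop (𝓝 (S ⟨x, hx⟩)) :=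
    tendsto_iff_norm_sub_tendsto_zero.2 (hsq _ (squeeze_zero (fun n => sq_nonneg _)
      (fun n => le_add_of_nonneg_right (sq_nonneg _)) h1))
  refine mem_closure_iff_seq_limit.2 ⟨fun n => (v n, S (v n)), fun n => ?_, h2.prodMk_nhds h3⟩
  refine (LinearPMap.mem_graph_iff _).2 ⟨⟨v n, hu n, (v n).2⟩, rfl, ?_⟩
  exact LinearPMap.domRestrict_apply rfl

variable [CompleteSpace H]

/-- For any positive square root `S` of `T`, the operator associated with `⟪S g, S h⟫` is
`S* S = S² = T`. -/
theorem isAssociated_ofOperator {S T : H →ₗ.[ℂ] H} (hS : IsPosSqrt S T) :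
    (ofOperator S).IsAssociated T := by
  intro x y
  rw [hS.sq]
  constructor
  · rintro ⟨z, hxz, hzy⟩
    obtain ⟨hx, rfl⟩ := mem_domain_of_mem_graph hxz
    exact ⟨hx, (mem_graph_iff_of_isSelfAdjoint hS.pos.selfAdjoint).1 hzy⟩
  · rintro ⟨hx, h⟩
    exact ⟨S ⟨x, hx⟩, S.mem_graph ⟨x, hx⟩, (mem_graph_iff_of_isSelfAdjoint hS.pos.selfAdjoint).2 h⟩

theorem isClosed_ofOperator {S : H →ₗ.[ℂ] H} (hS : S.IsClosed) : (ofOperator S).IsClosed := by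
  have hdist : ∀ x y : S.domain,
      (ofOperator S).plusOneNormSq (x - y) = ‖S x - S y‖ ^ 2 + ‖(x : H) - y‖ ^ 2 := fun x y => by
    rw [← S.map_sub]
    exact plusOneNormSq_ofOperator S (x - y)
  intro u hu
  have hcau : ∀ v : ℕ → H,
      (∀ m n, ‖v m - v n‖ ^ 2 ≤ (ofOperator S).plusOneNormSq (u m - u n)) → CauchySeq v := by
    intro v hv
    refine Metric.cauchySeq_iff.2 fun ε hε => ?_
    obtain ⟨N, hN⟩ := hu (ε ^ 2) (by positivity)
    refine ⟨N, fun m hm n hn => ?_⟩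
    rw [dist_eq_norm]
    exact lt_of_pow_lt_pow_left₀ 2 hε.le ((hv m n).trans_lt (hN m n hm hn))
  obtain ⟨x, hx⟩ := cauchySeq_tendsto_of_complete (hcau (fun n => (u n : H)) fun m n =>
    (le_add_of_nonneg_left (sq_nonneg _)).trans_eq (hdist (u m) (u n)).symm)
  obtain ⟨y, hy⟩ := cauchySeq_tendsto_of_complete (hcau (fun n => S (u n)) fun m n =>
    (le_add_of_nonneg_right (sq_nonneg _)).trans_eq (hdist (u m) (u n)).symm)
  have hxy : (x, y) ∈ S.graph :=
    hS.mem_of_tendsto (hx.prodMk_nhds hy) (Eventually.of_forall fun n => S.mem_graph (u n))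
  obtain ⟨hxS, rfl⟩ := mem_domain_of_mem_graph hxy
  refine ⟨⟨x, hxS⟩, ?_⟩
  have h1 := ((tendsto_iff_norm_sub_tendsto_zero.1 hy).pow 2).add
    ((tendsto_iff_norm_sub_tendsto_zero.1 hx).pow 2)
  rw [zero_pow two_ne_zero, add_zero] at h1
  exact h1.congr fun n => (hdist (u n) ⟨x, hxS⟩).symm

/-- First representation theorem: with `J` the embedding of the Hilbert space of a closed form `p`,
the operator associated with `p` is `(J J*)⁻¹ - 1`. -/
theorem exists_isAssociated {p : SesqForm H} (hp : p.IsPosSemidef) (hc : p.IsClosed) :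
    ∃ T : H →ₗ.[ℂ] H, IsPosOperator T ∧ p.IsAssociated T ∧
      ∀ w, ∃ x : T.domain, (x : H) + T x = w := by
  have := hc.completeSpace hp
  let J := embed hp
  let K : H →L[ℂ] FormSpace hp := J.adjoint
  have hK : ∀ (g : FormSpace hp) (w : H), ⟪g, K w⟫_ℂ = ⟪J g, w⟫_ℂ := fun g w =>
    ContinuousLinearMap.adjoint_inner_right J g w
  have hKinj : Function.Injective K := by
    rw [injective_iff_map_eq_zero]
    intro w hw
    refine (denseRange_embed hp).eq_zero_of_inner_right ℂ fun g => ?_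
    rw [← hK, hw, inner_zero_right]
  let A : H →L[ℂ] H := J.comp K
  have hinj : Function.Injective A := (embed_injective hp).comp hKinj
  -- `⟪A w, w - A w⟫ = p(A w, A w)`
  have hform : ∀ (h : p.domain) (w : H),
      p.form h ⟨A w, embed_mem hp _⟩ = ⟪(h : H), w - A w⟫_ℂ := by
    intro h w
    rw [form_eq_inner_sub hp, inner_sub_right]
    congr 1
    exact hK (toFormSpace hp h) w
  have hA : ∀ w, 0 ≤ ⟪A w, w - A w⟫_ℂ := fun w => by
    rw [← hform ⟨A w, embed_mem hp _⟩ w]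
    exact hp.nonneg _
  refine ⟨pairOperator A (1 - A), isPosOperator_pairOperator_one_sub hinj hA, fun x y => ?_,
    fun w => ?_⟩
  · rw [mem_graph_pairOperator hinj]
    constructor
    · rintro ⟨w, rfl, rfl⟩
      exact ⟨embed_mem hp _, fun h => hform h w⟩
    · rintro ⟨hx, h⟩
      have h1 : K (x + y) = toFormSpace hp ⟨x, hx⟩ := by
        refine ext_inner_left ℂ fun g => ?_
        rw [hK, ← toFormSpace_embed hp g, toFormSpace_inner, h, ← inner_add_right, add_comm]
        rfl
      have h2 : A (x + y) = x := congrArg J h1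
      refine ⟨x + y, h2, ?_⟩
      change x + y - A (x + y) = y
      rw [h2, add_sub_cancel_left]
  · obtain ⟨hx, h⟩ := mem_domain_of_mem_graph
      ((mem_graph_pairOperator (C := 1 - A) hinj).2 ⟨w, rfl, rfl⟩)
    refine ⟨⟨A w, hx⟩, ?_⟩
    rw [h]
    change A w + (w - A w) = w
    rw [add_sub_cancel]

end SesqForm

variable [CompleteSpace H]

/-- Second representation theorem: every closed form is the form of a positive self-adjoint
operator. -/
theorem exists_operatorForm_eq {p : SesqForm H} (hp : p.IsPosSemidef) (hc : p.IsClosed) :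
    ∃ T : H →ₗ.[ℂ] H, IsPosOperator T ∧ operatorForm T = p := by
  obtain ⟨T, hT, hpT, hsurj⟩ := SesqForm.exists_isAssociated hp hc
  have hS := hT.isPosSqrt_opSqrt
  obtain ⟨hSc, hSd⟩ := hS.pos.isClosed_and_dense
  exact ⟨T, hT, SesqForm.IsAssociated.form_unique (SesqForm.isPosSemidef_ofOperator hSd)
    (SesqForm.isClosed_ofOperator hSc) hp hc (SesqForm.isAssociated_ofOperator hS) hpT hsurj⟩

theorem IsPosOperator.eq_of_operatorForm_eq {T T' : H →ₗ.[ℂ] H} (hT : IsPosOperator T)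
    (hT' : IsPosOperator T') (h : operatorForm T = operatorForm T') : T = T' := by
  have h1 : (operatorForm T).IsAssociated T :=
    SesqForm.isAssociated_ofOperator hT.isPosSqrt_opSqrt
  have h2 : (operatorForm T').IsAssociated T' :=
    SesqForm.isAssociated_ofOperator hT'.isPosSqrt_opSqrt
  rw [h] at h1
  exact h1.unique h2

end AssociatedOperator

/-! ### The form of an absolutely continuous NC measure -/

section Toeplitz

variable {d : ℕ}

theorem leftShift_mem_freeDiskAlgebra (k : Fin d) : leftShift d k ∈ freeDiskAlgebra d :=
  Subalgebra.le_topologicalClosure _ (Algebra.subset_adjoin ⟨k, rfl⟩)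

theorem leftShift_mem_diskSubspace (k : Fin d) {h : Fock d} (hh : h ∈ diskSubspace d) :
    leftShift d k h ∈ diskSubspace d := by
  obtain ⟨a, rfl⟩ := hh
  exact ⟨⟨leftShift d k, leftShift_mem_freeDiskAlgebra k⟩ * a, rfl⟩

theorem basisVec_mem_diskSubspace (α : FreeMonoid (Fin d)) : basisVec d α ∈ diskSubspace d := by
  induction α using FreeMonoid.recOn with
  | one => exact ⟨1, rfl⟩
  | of_mul k α h =>
    rw [← leftShift_basisVec]
    exact leftShift_mem_diskSubspace k h

theorem dense_diskSubspace (d : ℕ) : Dense (diskSubspace d : Set (Fock d)) := by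
  classical
  intro f
  refine mem_closure_of_tendsto (lp.hasSum_single (p := 2) (by norm_num) f)
    (Eventually.of_forall fun s => Submodule.sum_mem _ fun α _ => ?_)
  have h : lp.single 2 α (f α) = f α • basisVec d α := by
    refine lp.ext (funext fun w => ?_)
    rw [lp.coeFn_smul, Pi.smul_apply, basisVec_apply, lp.single_apply, Pi.single_apply]
    split_ifs with h
    · subst h; simp
    · simp
  rw [h]
  exact Submodule.smul_mem _ _ (basisVec_mem_diskSubspace α)

theorem inner_leftShift_leftShift (j k : Fin d) (g h : Fock d) :
    ⟪leftShift d j g, leftShift d k h⟫_ℂ = if j = k then ⟪g, h⟫_ℂ else 0 := by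
  have h1 := congrArg (fun X : Fock d →L[ℂ] Fock d => ⟪g, X h⟫_ℂ) (star_leftShift_mul d j k)
  rw [← ContinuousLinearMap.adjoint_inner_right, ← ContinuousLinearMap.star_eq_adjoint]
  refine h1.trans ?_
  split_ifs
  · rfl
  · exact inner_zero_right g

/-- The Toeplitz property of `q_μ`: `(L_j a)* (L_k b) = δ_{jk} a* b`. -/
theorem measureForm_leftShift (μ : NCMeasure d) (j k : Fin d) (g h : diskSubspace d) :
    (measureForm μ).form ⟨leftShift d j g, leftShift_mem_diskSubspace j g.2⟩
      ⟨leftShift d k h, leftShift_mem_diskSubspace k h.2⟩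
      = if j = k then (measureForm μ).form g h else 0 := by
  obtain ⟨a, ha⟩ := g.2
  obtain ⟨b, hb⟩ := h.2
  have eg : g = ⟨vacuumMap d a, LinearMap.mem_range_self _ a⟩ := Subtype.ext ha.symm
  have eh : h = ⟨vacuumMap d b, LinearMap.mem_range_self _ b⟩ := Subtype.ext hb.symm
  let a' : freeDiskAlgebra d := ⟨leftShift d j, leftShift_mem_freeDiskAlgebra j⟩ * a
  let b' : freeDiskAlgebra d := ⟨leftShift d k, leftShift_mem_freeDiskAlgebra k⟩ * b
  have eg' : (⟨leftShift d j g, leftShift_mem_diskSubspace j g.2⟩ : diskSubspace d)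
      = ⟨vacuumMap d a', LinearMap.mem_range_self _ a'⟩ :=
    Subtype.ext (congrArg (leftShift d j) ha.symm)
  have eh' : (⟨leftShift d k h, leftShift_mem_diskSubspace k h.2⟩ : diskSubspace d)
      = ⟨vacuumMap d b', LinearMap.mem_range_self _ b'⟩ :=
    Subtype.ext (congrArg (leftShift d k) hb.symm)
  have h1 : star (a' : Fock d →L[ℂ] Fock d) * b'
      = star (a : Fock d →L[ℂ] Fock d) * ((star (leftShift d j) * leftShift d k) * b) := by
    change star (leftShift d j * (a : Fock d →L[ℂ] Fock d)) * (leftShift d k * b) = _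
    simp only [star_mul, mul_assoc]
  rw [star_leftShift_mul] at h1
  let F : diskSubspace d → diskSubspace d → ℂ := fun x y => (measureForm μ).form x y
  have h2 := (congrArg₂ F eg' eh').trans (measureForm_vacuumMap μ a' b')
  have h3 := (congrArg₂ F eg eh).trans (measureForm_vacuumMap μ a b)
  refine h2.trans ?_
  split_ifs at h1 ⊢
  · rw [one_mul] at h1
    exact (congrArg μ (Subtype.ext h1)).trans h3.symm
  · rw [zero_mul, mul_zero] at h1
    exact (congrArg μ (Subtype.ext h1)).trans (map_zero μ)

/-- The closure of a form with the `L`-Toeplitz property is `L`-Toeplitz: the shifts are isometric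
for `‖·‖_{p+1}` on a core, so they preserve the completion. -/
theorem isLToeplitzForm_of_isFormCore {q p : SesqForm (Fock d)} (hp : p.IsPosSemidef)
    (hc : p.IsClosed) (hqp : q.IsExtendedBy p) (hcore : SesqForm.IsFormCore hp q.domain)
    (hinv : ∀ (k : Fin d) (h : Fock d), h ∈ q.domain → leftShift d k h ∈ q.domain)
    (htoep : ∀ (j k : Fin d) (g h : q.domain),
      q.form ⟨leftShift d j g, hinv j g g.2⟩ ⟨leftShift d k h, hinv k h h.2⟩
        = if j = k then q.form g h else 0) :
    IsLToeplitzForm p := by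
  have := hc.completeSpace hp
  obtain ⟨hle, hext⟩ := hqp
  have hin : ∀ (j k : Fin d) (g h : q.domain),
      ⟪SesqForm.toFormSpace hp ⟨leftShift d j g, hle (hinv j g g.2)⟩,
        SesqForm.toFormSpace hp ⟨leftShift d k h, hle (hinv k h h.2)⟩⟫_ℂ
      = if j = k then ⟪SesqForm.toFormSpace hp ⟨g, hle g.2⟩,
          SesqForm.toFormSpace hp ⟨h, hle h.2⟩⟫_ℂ else 0 := by
    intro j k g h
    have h1 := hext ⟨leftShift d j g, hinv j g g.2⟩ ⟨leftShift d k h, hinv k h h.2⟩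
    have h2 := hext g h
    rw [SesqForm.toFormSpace_inner, SesqForm.toFormSpace_inner, h1, h2, htoep,
      inner_leftShift_leftShift]
    split_ifs
    · rfl
    · exact add_zero 0
  have key : ∀ (k : Fin d) (h : SesqForm.FormSpace hp),
      ∃ (h' : SesqForm.FormSpace hp) (u : ℕ → q.domain),
      Tendsto (fun n => SesqForm.toFormSpace hp ⟨u n, hle (u n).2⟩) atTop (𝓝 h) ∧
      Tendsto (fun n => SesqForm.toFormSpace hp ⟨leftShift d k (u n), hle (hinv k _ (u n).2)⟩)
        atTop (𝓝 h') ∧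
      SesqForm.embed hp h' = leftShift d k (SesqForm.embed hp h) := by
    intro k h
    obtain ⟨w, hw, hlim⟩ := mem_closure_iff_seq_limit.1 (hcore h)
    let u : ℕ → q.domain := fun n => ⟨SesqForm.embed hp (w n), hw n⟩
    have hu : Tendsto (fun n => SesqForm.toFormSpace hp ⟨u n, hle (u n).2⟩) atTop (𝓝 h) := hlim
    have hcau : CauchySeq fun n =>
        SesqForm.toFormSpace hp ⟨leftShift d k (u n), hle (hinv k _ (u n).2)⟩ := by
      have h1 := hu.cauchySeq
      rw [Metric.cauchySeq_iff] at h1 ⊢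
      have h2 : ∀ m n, dist
          (SesqForm.toFormSpace hp ⟨leftShift d k (u m), hle (hinv k _ (u m).2)⟩)
          (SesqForm.toFormSpace hp ⟨leftShift d k (u n), hle (hinv k _ (u n).2)⟩)
          = dist (SesqForm.toFormSpace hp ⟨u m, hle (u m).2⟩)
            (SesqForm.toFormSpace hp ⟨u n, hle (u n).2⟩) := by
        intro m n
        have h3 := hin k k (u m - u n) (u m - u n)
        rw [if_pos rfl] at h3
        rw [dist_eq_norm, dist_eq_norm, ← map_sub, ← map_sub, @norm_eq_sqrt_re_inner ℂ,
          @norm_eq_sqrt_re_inner ℂ (SesqForm.FormSpace hp)]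
        have e1 : (⟨leftShift d k (u m), hle (hinv k _ (u m).2)⟩ : p.domain)
            - ⟨leftShift d k (u n), hle (hinv k _ (u n).2)⟩
            = ⟨leftShift d k (u m - u n : q.domain), hle (hinv k _ (u m - u n).2)⟩ :=
          Subtype.ext (map_sub (leftShift d k) _ _).symm
        rw [e1, h3]
        rfl
      simpa only [h2] using h1
    obtain ⟨h', hh'⟩ := cauchySeq_tendsto_of_complete hcau
    refine ⟨h', u, hu, hh', ?_⟩
    have e1 := ((SesqForm.embed hp).continuous.tendsto h').comp hh'
    have e2 := ((leftShift d k).continuous.comp (SesqForm.embed hp).continuous).tendsto h |>.comp hu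
    exact tendsto_nhds_unique e1 e2
  have hpinv : ∀ (k : Fin d) (h : Fock d), h ∈ p.domain → leftShift d k h ∈ p.domain := by
    intro k h hh
    obtain ⟨h', -, -, -, he⟩ := key k (SesqForm.toFormSpace hp ⟨h, hh⟩)
    have he' : SesqForm.embed hp h' = leftShift d k h := he
    exact he' ▸ SesqForm.embed_mem hp h'
  refine ⟨hp, hpinv, fun j k g h => ?_⟩
  obtain ⟨g', u, hu, hu', hg⟩ := key j (SesqForm.toFormSpace hp g)
  obtain ⟨h', v, hv, hv', hh⟩ := key k (SesqForm.toFormSpace hp h)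
  have h1 := hu'.inner (𝕜 := ℂ) hv'
  have h2 := hu.inner (𝕜 := ℂ) hv
  have hg' : SesqForm.toFormSpace hp ⟨leftShift d j g, hpinv j g g.2⟩ = g' :=
    SesqForm.embed_injective hp hg.symm
  have hh' : SesqForm.toFormSpace hp ⟨leftShift d k h, hpinv k h h.2⟩ = h' :=
    SesqForm.embed_injective hp hh.symm
  rw [SesqForm.form_eq_inner_sub hp, SesqForm.form_eq_inner_sub hp, hg', hh']
  change _ - ⟪leftShift d j g, leftShift d k h⟫_ℂ = _
  rw [inner_leftShift_leftShift]
  simp only [hin] at h1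
  split_ifs at h1 ⊢
  · rw [tendsto_nhds_unique h1 h2]
  · rw [tendsto_nhds_unique h1 tendsto_const_nhds, sub_zero]

end Toeplitz

end NCFatou

theorem theorem4p3 (d : ℕ) (μ : NCMeasure d) (hμ : NCMeasure.IsAbsolutelyContinuous μ) :
    ∃ T : Fock d →ₗ.[ℂ] Fock d,
      (IsLToeplitzOperator T ∧ (measureForm μ).IsClosure (operatorForm T)) ∧
      (∀ T' : Fock d →ₗ.[ℂ] Fock d,
        IsLToeplitzOperator T' ∧ (measureForm μ).IsClosure (operatorForm T') → T' = T) ∧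
      (opSqrt T).HasCore (diskSubspace d) := by
  obtain ⟨p, hp, hcl, hcore⟩ := SesqForm.IsClosable.exists_isClosure hμ (dense_diskSubspace d)
  obtain ⟨T, hT, rfl⟩ := exists_operatorForm_eq hp hcl.closed
  refine ⟨T, ⟨⟨hT, ?_⟩, hcl⟩, fun T' hT' => ?_, ?_⟩
  · exact isLToeplitzForm_of_isFormCore hp hcl.closed hcl.extends_form hcore
      (fun k _ hh => leftShift_mem_diskSubspace k hh) (measureForm_leftShift μ)
  · exact hT'.1.pos.eq_of_operatorForm_eq hT (hT'.2.unique hcl)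
  · exact SesqForm.IsFormCore.hasCore hT.isPosSqrt_opSqrt.pos.isClosed_and_dense.1
      hcl.extends_form.1 hcore
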